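/- Let $F$ be a field of characteristic $2$, write $F^2=\{x^2 : x\in F\}$, and let $Q$ be an $F$-quaternion division algebra, i.e. a division algebra with centre $F$ and $\dim_F Q=4$. An $F$-involution on $Q$ is an $F$-linear map $\theta:Q\to Q$ with $\theta(xy)=\theta(y)\theta(x)$ and $\theta^2=\mathrm{id}$; put $\mathrm{Alt}(Q,\theta)=\{a-\theta(a) : a\in Q\}$. A hermitian form over $(Q,\theta)$ is a finite-dimensional right $Q$-vector space $V$ with a bi-additive map $h:V\times V\to Q$ such that $h(xd_1,yd_2)=\theta(d_1)h(x,y)d_2$ and $h(y,x)=\theta(h(x,y))$ for all $x,y\in V$ and $d_1,d_2\in Q$; it is anisotropic if $h(x,x)\neq 0$ for all $x\neq 0$, and nondegenerate if only $x=0$ satisfies $h(x,y)=0$ for all $y\in V$. A quadratic form over $(Q,\theta)$ is a finite-dimensional right $Q$-vector space $V$ with a map $q:V\to Q/\mathrm{Alt}(Q,\theta)$ such that $q(xd)=\theta(d)q(x)d$ for all $x\in V$, $d\in Q$, and such that there is a (necessarily unique) hermitian form $h$ over $(Q,\theta)$ on $V$, the polar form of $q$, with $q(x+y)-q(x)-q(y)=h(x,y)+\mathrm{Alt}(Q,\theta)$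 for all $x,y\in V$; it is anisotropic if $q(x)\neq 0$ for all $x\neq 0$, and nonsingular if its polar form is nondegenerate. Let $u^+(Q)$, $u(Q)$ and $\widetilde u(Q)$ be the suprema of the dimensions $\dim_Q V$ of, respectively, the anisotropic hermitian forms, the anisotropic quadratic forms, and the anisotropic nonsingular quadratic forms over $(Q,\theta)$. Suppose that $[F:F^2]=2$. Then $F$-involutions on $Q$ exist, and for every choice of the $F$-involution $\theta$ in these definitions $$u^+(Q)=2\qquad\text{and}\qquad u(Q)=\widetilde u(Q)=3 .$$ This applies in particular to local fields of characteristic $2$: if $F\simeq\mathbb F_{2^n}((t))$ for some $n\geq 1$, then $[F:F^2]=2$, and hence the conclusion holds for every $F$-quaternion division algebra $Q$. -/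

import Mathlib

namespace GenQuad

universe u v w

section Algebras

variable (F : Type u) (A : Type v) [Field F] [Ring A] [Algebra F A]

/-- An `F`-linear involution (involution of the first kind) on the `F`-algebra `A`. -/
structure Involution extends A →ₗ[F] A where
  map_mul' : ∀ x y : A, toFun (x * y) = toFun y * toFun x
  involutive' : ∀ x : A, toFun (toFun x) = x

/-- An `F`-quaternion algebra: a central simple `F`-algebra of degree `2`. -/
structure IsQuaternionAlgebra : Prop where
  isCentral : Algebra.IsCentral F A
  isSimple : IsSimpleRing A
  finrank_eq : Module.finrank F A = 2 ^ 2

end Algebras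

/-- The degree `[F : F²]` is `n`, for a field `F` of characteristic `2`; here `F²` is the subfield
of squares, the image of the Frobenius map `x ↦ x ^ 2`. The natural number `n` is meant to be
positive, so that the extension is finite. -/
def DegreeOverSquaresEq (F : Type u) [Field F] [CharP F 2] (n : ℕ) : Prop :=
  Module.finrank (frobenius F 2).fieldRange F = n

/-- A local field of characteristic `2`: a field isomorphic to the field of Laurent series in one
variable over the field with `2 ^ n` elements, for some `n ≥ 1`. -/
def IsLocalFieldCharTwo (F : Type u) [Field F] : Prop :=
  ∃ n : ℕ, 1 ≤ n ∧ Nonempty (F ≃+* LaurentSeries (GaloisField 2 n))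

section Forms

variable {F : Type u} {D : Type v} [Field F] [DivisionRing D] [Algebra F D]

namespace Involution

/-- `Alt(D, θ) = {a - θ(a) | a ∈ D}`. -/
def alt (θ : Involution F D) : Submodule F D :=
  LinearMap.range ((LinearMap.id : D →ₗ[F] D) - θ.toLinearMap)

/-- The map `a ↦ θ(d) a d` on `D`. -/
def sandwich (θ : Involution F D) (d : D) : D →ₗ[F] D :=
  (LinearMap.mulLeft F (θ.toLinearMap d)).comp (LinearMap.mulRight F d)

theorem sandwich_mem_alt (θ : Involution F D) (d : D) :
    θ.alt ≤ θ.alt.comap (θ.sandwich d) := by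
  rintro _ ⟨a, rfl⟩
  refine ⟨θ.sandwich d a, ?_⟩
  have h1 : ∀ x y : D, θ.toLinearMap (x * y) = θ.toLinearMap y * θ.toLinearMap x := θ.map_mul'
  have h2 : ∀ x : D, θ.toLinearMap (θ.toLinearMap x) = x := θ.involutive'
  simp [sandwich, h1, h2, sub_mul, mul_sub, mul_assoc]

/-- The map `a + Alt(D, θ) ↦ θ(d) a d + Alt(D, θ)` on `D / Alt(D, θ)`. -/
def quotSandwich (θ : Involution F D) (d : D) : (D ⧸ θ.alt) →ₗ[F] (D ⧸ θ.alt) :=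
  θ.alt.mapQ θ.alt (θ.sandwich d) (θ.sandwich_mem_alt d)

end Involution

/-- A hermitian form over `(D, θ)` on the right `D`-vector space `V`; right vector spaces are
modules over the opposite ring, so that `x d` is written `MulOpposite.op d • x`. -/
structure HermitianForm (θ : Involution F D) (V : Type w) [AddCommGroup V] [Module Dᵐᵒᵖ V] where
  toFun : V → V → D
  add_left : ∀ x x' y : V, toFun (x + x') y = toFun x y + toFun x' y
  add_right : ∀ x y y' : V, toFun x (y + y') = toFun x y + toFun x y'
  smul_smul : ∀ (x y : V) (d₁ d₂ : D),
    toFun (MulOpposite.op d₁ • x) (MulOpposite.op d₂ • y) = θ.toFun d₁ * toFun x y * d₂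
  symm : ∀ x y : V, toFun y x = θ.toFun (toFun x y)

namespace HermitianForm

variable {θ : Involution F D} {V : Type w} [AddCommGroup V] [Module Dᵐᵒᵖ V]

/-- The radical of the form is zero. -/
def Nondegenerate (h : HermitianForm θ V) : Prop :=
  ∀ x : V, (∀ y : V, h.toFun x y = 0) → x = 0

/-- The form does not represent `0`. -/
def Anisotropic (h : HermitianForm θ V) : Prop :=
  ∀ x : V, x ≠ 0 → h.toFun x x ≠ 0

end HermitianForm

/-- A (generalised) quadratic form over `(D, θ)` on the right `D`-vector space `V`, together with
its polar form, which is uniquely determined by the map `q` (see `QuadForm.polar_unique`). -/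
structure QuadForm (θ : Involution F D) (V : Type w) [AddCommGroup V] [Module Dᵐᵒᵖ V] where
  toFun : V → D ⧸ θ.alt
  polar : HermitianForm θ V
  map_smul : ∀ (x : V) (d : D), toFun (MulOpposite.op d • x) = θ.quotSandwich d (toFun x)
  map_add : ∀ x y : V,
    toFun (x + y) - toFun x - toFun y = Submodule.Quotient.mk (p := θ.alt) (polar.toFun x y)

namespace QuadForm

variable {θ : Involution F D} {V : Type w} [AddCommGroup V] [Module Dᵐᵒᵖ V]

/-- The polar form is nondegenerate. -/
def Nonsingular (q : QuadForm θ V) : Prop := q.polar.Nondegenerate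

/-- The form does not represent `0`, that is, `q(x)` is nonzero in `D / Alt(D, θ)` for `x ≠ 0`. -/
def Anisotropic (q : QuadForm θ V) : Prop :=
  ∀ x : V, x ≠ 0 → q.toFun x ≠ 0

/-- The polar form is determined by the quadratic map. -/
theorem polar_unique [FiniteDimensional F D] (q q' : QuadForm θ V) (hq : q.toFun = q'.toFun)
    (x y : V) : q.polar.toFun x y = q'.polar.toFun x y := by
  have h1 : ∀ a b : D, θ.toLinearMap (a * b) = θ.toLinearMap b * θ.toLinearMap a := θ.map_mul'
  have h2 : ∀ a : D, θ.toLinearMap (θ.toLinearMap a) = a := θ.involutive'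
  have hone : θ.toLinearMap 1 = 1 := by
    have h := h1 (θ.toLinearMap 1) 1
    rw [mul_one, h2, mul_one] at h
    exact h.symm
  by_contra hne
  have hmem : ∀ d : D, (q.polar.toFun x y - q'.polar.toFun x y) * d ∈ θ.alt := by
    intro d
    have e := q.map_add x (MulOpposite.op d • y)
    rw [hq, q'.map_add, Submodule.Quotient.eq] at e
    have e1 := q.polar.smul_smul x y 1 d
    have e2 := q'.polar.smul_smul x y 1 d
    have hone' : θ.toFun 1 = 1 := hone
    rw [MulOpposite.op_one, one_smul, hone', one_mul] at e1 e2
    rw [e1, e2] at e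
    have := θ.alt.neg_mem e
    rwa [neg_sub, ← sub_mul] at this
  have htop : Function.Surjective ((LinearMap.id : D →ₗ[F] D) - θ.toLinearMap) := by
    intro a
    have := hmem ((q.polar.toFun x y - q'.polar.toFun x y)⁻¹ * a)
    rwa [mul_inv_cancel_left₀ (sub_ne_zero.mpr hne)] at this
  have hinj := LinearMap.injective_iff_surjective.mpr htop
  have : (1 : D) = 0 := hinj (by simp [hone])
  exact one_ne_zero this

end QuadForm

/-- `u⁺`: the supremum of the dimensions of the anisotropic hermitian forms over `(D, θ)`. -/
noncomputable def uPlus (θ : Involution F D) : ℕ∞ :=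
  sSup {n : ℕ∞ | ∃ (V : Type v) (_ : AddCommGroup V) (_ : Module Dᵐᵒᵖ V)
    (_ : Module.Finite Dᵐᵒᵖ V) (h : HermitianForm θ V),
    h.Anisotropic ∧ n = (Module.finrank Dᵐᵒᵖ V : ℕ∞)}

/-- `u`: the supremum of the dimensions of the anisotropic quadratic forms over `(D, θ)`. -/
noncomputable def uQuad (θ : Involution F D) : ℕ∞ :=
  sSup {n : ℕ∞ | ∃ (V : Type v) (_ : AddCommGroup V) (_ : Module Dᵐᵒᵖ V)
    (_ : Module.Finite Dᵐᵒᵖ V) (q : QuadForm θ V),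
    q.Anisotropic ∧ n = (Module.finrank Dᵐᵒᵖ V : ℕ∞)}

/-- `ũ`: the supremum of the dimensions of the anisotropic nonsingular quadratic forms over
`(D, θ)`. -/
noncomputable def uTilde (θ : Involution F D) : ℕ∞ :=
  sSup {n : ℕ∞ | ∃ (V : Type v) (_ : AddCommGroup V) (_ : Module Dᵐᵒᵖ V)
    (_ : Module.Finite Dᵐᵒᵖ V) (q : QuadForm θ V),
    q.Anisotropic ∧ q.Nonsingular ∧ n = (Module.finrank Dᵐᵒᵖ V : ℕ∞)}

end Forms

end GenQuad

/-!
Write `n = [F : F²]`. A Frobenius-semilinear map into a space of dimension `m` has a kernel of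
codimension at most `nm` over `F`. For an anisotropic hermitian form, `x ↦ h(x, x)` is semilinear
modulo `Alt(Q, θ)` with values in the plane `Sym(Q, θ) / Alt(Q, θ)`, and on its kernel it is an
anisotropic quadratic map into the line `Alt(Q, θ)`. Over `F` such a map has dimension at most `2n`,
because its polar form is alternating and the map is semilinear on a totally isotropic subspace.
Hence `4 dim_Q V ≤ 2n + 2n`. For an anisotropic quadratic form, split off a maximal totally
isotropic subspace `W` for the polar form `h`, with a complement `C` in the orthogonal space of `W`,
on which `h` is anisotropic. On `W` the values of `q` lie in `Sym(Q, θ) / Alt(Q, θ)`, so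
`4 dim W ≤ 2n`, and on `C` the values `h(x, x) = q(x) + θ(q(x))` lie in the line `Alt(Q, θ)`, so
`4 dim C ≤ 2n`. Therefore `dim V ≤ 2 dim W + dim C ≤ 3n/2`.

These bounds are attained for `n = 2`. If `s ≠ 0` spans `Alt(Q, θ)` and `c` is symmetric but not
alternating, then `⟨s, c⟩` is anisotropic. Moreover `s⁻¹ θ(·) s` is the quaternion conjugation, and
`⟨s c₀, s c₁, s c₂⟩` is anisotropic and nonsingular if the `cᵢ` have reduced trace `1` and their
reduced norms sum to `0`: a zero would produce an element of `Q` of reduced trace `1` and reduced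
norm of the form `f² + f`, which a division algebra does not contain.
-/

namespace GenQuad

open Module

open scoped Quaternion

section SemilinearAlgebra

theorem finrank_le_finrank_ker_add_of_semilinear {F K V W : Type*} [Field F] [Field K]
    {σ : F →+* K} [AddCommGroup V] [Module F V] [FiniteDimensional F V] [AddCommGroup W]
    [Module K W] [FiniteDimensional K W] (hσ : finrank σ.fieldRange K ≠ 0) (f : V →ₛₗ[σ] W) :
    finrank F V ≤ finrank F (LinearMap.ker f) + finrank σ.fieldRange K * finrank K W := by
  algebraize [σ]
  let _ : Module F W := Module.compHom W σ
  have : IsScalarTower F K W := IsScalarTower.of_algebraMap_smul fun _ _ => rfl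
  have hdeg : finrank F K = finrank σ.fieldRange K :=
    Algebra.finrank_eq_of_equiv_equiv σ.rangeRestrictFieldEquiv (RingEquiv.refl K) rfl
  have : FiniteDimensional F K := finite_of_finrank_pos (hdeg ▸ Nat.pos_of_ne_zero hσ)
  have : FiniteDimensional F W := FiniteDimensional.trans F K W
  let g : V →ₗ[F] W := { f with map_smul' := fun c x => f.map_smulₛₗ c x }
  calc finrank F V = finrank F (LinearMap.range g) + finrank F (LinearMap.ker g) :=
        g.finrank_range_add_finrank_ker.symm
    _ ≤ finrank F W + finrank F (LinearMap.ker g) := by gcongr; exact Submodule.finrank_le _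
    _ = finrank F (LinearMap.ker f) + finrank σ.fieldRange K * finrank K W := by
        rw [add_comm, ← finrank_mul_finrank F K W, hdeg]; rfl

end SemilinearAlgebra

section Isotropic

variable {K V M : Type*} [DivisionRing K] [AddCommGroup V] [Module K V] [FiniteDimensional K V]
  [AddCommGroup M] [Module K M]

theorem finrank_le_finrank_add_finrank_iInf_ker (hM : finrank K M = 1) {B : V → V →ₗ[K] M}
    (hB : ∀ x y, B x y = 0 → B y x = 0) (W : Submodule K V) :
    finrank K V ≤ finrank K W + finrank K ↥(⨅ x ∈ W, LinearMap.ker (B x)) := by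
  have : FiniteDimensional K M := finite_of_finrank_pos (hM ▸ one_pos)
  let b := finBasis K W
  let f : V →ₗ[K] Fin (finrank K W) → M := LinearMap.pi fun i => B (b i)
  have hker : LinearMap.ker f ≤ ⨅ x ∈ W, LinearMap.ker (B x) := by
    intro y hy
    have hW : W ≤ LinearMap.ker (B y) := by
      have hb : B y ∘ₗ W.subtype = 0 := b.ext fun i => hB _ _ (congrFun hy i)
      exact fun x hx => LinearMap.congr_fun hb ⟨x, hx⟩
    simp only [Submodule.mem_iInf]
    exact fun x hx => hB _ _ (hW hx)
  calc finrank K V = finrank K (LinearMap.range f) + finrank K (LinearMap.ker f) :=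
        f.finrank_range_add_finrank_ker.symm
    _ ≤ finrank K W + finrank K ↥(⨅ x ∈ W, LinearMap.ker (B x)) := by
        gcongr
        · exact (Submodule.finrank_le _).trans (by simp [finrank_pi_fintype, hM])
        · exact Submodule.finrank_mono hker

theorem exists_isotropic_anisotropic_finrank_le (hM : finrank K M = 1) {B : V → V →ₗ[K] M}
    (hB : ∀ x y, B x y = 0 → B y x = 0) :
    ∃ W C : Submodule K V, (∀ x ∈ W, ∀ y ∈ W, B x y = 0) ∧ (∀ x ∈ C, B x x = 0 → x = 0) ∧
      finrank K V ≤ 2 * finrank K W + finrank K C := by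
  obtain ⟨W, hW, hmax⟩ := exists_maximal_of_wellFoundedGT
    (fun W : Submodule K V => ∀ x ∈ W, ∀ y ∈ W, B x y = 0) ⟨⊥, by simp⟩
  obtain ⟨C, hC⟩ := W.exists_isCompl
  set P : Submodule K V := ⨅ x ∈ W, LinearMap.ker (B x)
  have mem_P {y : V} : y ∈ P ↔ ∀ x ∈ W, B x y = 0 := by simp [P, Submodule.mem_iInf]
  refine ⟨W, C ⊓ P, hW, fun c ⟨hcC, hcP⟩ hc => ?_, ?_⟩
  · have hisotropic : ∀ x ∈ W ⊔ K ∙ c, ∀ y ∈ W ⊔ K ∙ c, B x y = 0 := by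
      have hleft : ∀ y, (∀ w ∈ W, B y w = 0) → B y c = 0 → ∀ x ∈ W ⊔ K ∙ c, B y x = 0 := by
        intro y hy hyc
        have : W ⊔ K ∙ c ≤ LinearMap.ker (B y) := by simpa [Submodule.span_le] using ⟨hy, hyc⟩
        exact this
      have hcW := hleft c (fun w hw => hB _ _ (mem_P.1 hcP w hw)) hc
      exact fun x hx => hleft x
        (fun w hw => hB _ _ (hleft w (hW w hw) (mem_P.1 hcP w hw) x hx)) (hB _ _ (hcW x hx))
    have hcW : c ∈ W := hmax hisotropic le_sup_left
      (Submodule.mem_sup_right (Submodule.mem_span_singleton_self c))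
    exact (Submodule.disjoint_def.1 hC.disjoint) c hcW hcC
  · have hsup : W ⊔ C ⊓ P = P := by
      rw [← sup_inf_assoc_of_le C fun x hx => mem_P.2 fun w hw => hW w hw x hx, hC.sup_eq_top,
        top_inf_eq]
    have hP := Submodule.finrank_add_le_finrank_add_finrank W (C ⊓ P)
    rw [hsup] at hP
    calc finrank K V ≤ finrank K W + finrank K P := finrank_le_finrank_add_finrank_iInf_ker hM hB W
      _ ≤ finrank K W + (finrank K W + finrank K ↥(C ⊓ P)) := by
          gcongr
      _ = 2 * finrank K W + finrank K ↥(C ⊓ P) := by ring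

end Isotropic

section QuadraticMaps

variable {F V N : Type*} [Field F] [CharP F 2] [AddCommGroup V] [Module F V]
  [FiniteDimensional F V] [AddCommGroup N] [Module F N] {n : ℕ}

theorem exists_le_finrank_le_of_polar_eq_zero (hF : DegreeOverSquaresEq F n) (hn : n ≠ 0)
    (φ : QuadraticMap F V N) {U : Submodule F V} {S : Submodule F N} [FiniteDimensional F S]
    (hpolar : ∀ x ∈ U, ∀ y ∈ U, QuadraticMap.polar φ x y = 0) (hS : ∀ x ∈ U, φ x ∈ S) :
    ∃ U' ≤ U, (∀ x ∈ U', φ x = 0) ∧ finrank F U ≤ finrank F U' + n * finrank F S := by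
  let f : U →ₛₗ[frobenius F 2] S :=
    { toFun := fun x => ⟨φ x, hS x x.2⟩
      map_add' := fun x y => Subtype.ext <| by
        simp [QuadraticMap.map_add φ, hpolar x x.2 y y.2]
      map_smul' := fun c x => Subtype.ext <| by
        simp [QuadraticMap.map_smul, frobenius_def, sq] }
  refine ⟨(LinearMap.ker f).map U.subtype, Submodule.map_subtype_le _ _, ?_, ?_⟩
  · rintro _ ⟨x, hx, rfl⟩
    exact congrArg Subtype.val hx
  · rw [Submodule.finrank_map_subtype_eq, ← hF]
    exact finrank_le_finrank_ker_add_of_semilinear (hF.trans_ne hn) f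

theorem finrank_le_two_mul_of_anisotropic (hF : DegreeOverSquaresEq F n) (hn : n ≠ 0)
    (φ : QuadraticMap F V N) {U : Submodule F V} {S : Submodule F N} (hS₁ : finrank F S = 1)
    (hS : ∀ x ∈ U, φ x ∈ S) (hanis : ∀ x ∈ U, φ x = 0 → x = 0) : finrank F U ≤ 2 * n := by
  have : FiniteDimensional F S := finite_of_finrank_pos (hS₁ ▸ one_pos)
  have polar_mem (x y : U) : QuadraticMap.polar φ x y ∈ S :=
    S.sub_mem (S.sub_mem (hS _ (x + y).2) (hS _ x.2)) (hS _ y.2)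
  let B (x : U) : U →ₗ[F] S :=
    (φ.polarBilin x ∘ₗ U.subtype).codRestrict S fun y => polar_mem x y
  have B_eq_zero {x y : U} : B x y = 0 ↔ QuadraticMap.polar φ x y = 0 := Subtype.ext_iff
  obtain ⟨W, C, hW, hC, hle⟩ := exists_isotropic_anisotropic_finrank_le hS₁ (B := B)
    fun x y h => B_eq_zero.2 (QuadraticMap.polar_comm φ x y ▸ B_eq_zero.1 h)
  have hC₀ : C = ⊥ := (Submodule.eq_bot_iff C).2 fun x hx => hC x hx <| B_eq_zero.2 <| by
    rw [QuadraticMap.polar_self, ← Nat.cast_smul_eq_nsmul F,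
      CharP.cast_eq_zero, zero_smul]
  obtain ⟨U', hU', hzero, hfinrank⟩ := exists_le_finrank_le_of_polar_eq_zero hF hn φ
    (U := W.map U.subtype) (S := S)
    (by rintro _ ⟨x, hx, rfl⟩ _ ⟨y, hy, rfl⟩; exact B_eq_zero.1 (hW x hx y hy))
    (by rintro _ ⟨x, -, rfl⟩; exact hS x x.2)
  have hU'₀ : U' = ⊥ := (Submodule.eq_bot_iff U').2 fun x hx =>
    hanis x (Submodule.map_subtype_le _ _ (hU' hx)) (hzero x hx)
  rw [Submodule.finrank_map_subtype_eq, hU'₀, finrank_bot, hS₁] at hfinrank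
  rw [hC₀, finrank_bot] at hle
  omega

end QuadraticMaps

section Structure

variable {F D : Type*} [Field F] [DivisionRing D] [Algebra F D]

theorem eq_zero_of_commute_of_add_mul_eq_zero {x y c d : D} (hxy : ¬Commute x y)
    (hc : Commute x c) (hd : Commute x d) (h : c + d * y = 0) : c = 0 ∧ d = 0 := by
  have hd₀ : d = 0 := by
    by_contra hne
    refine hxy ?_
    rw [show y = d⁻¹ * -c from (eq_inv_mul_iff_mul_eq₀ hne).2 (eq_neg_of_add_eq_zero_right h)]
    exact hd.inv_right₀.mul_right hc.neg_right
  subst hd₀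
  simpa using h

variable (F) in
theorem mem_centralizer_singleton_iff {x z : D} :
    z ∈ Subalgebra.centralizer F {x} ↔ Commute x z := by
  simp [Subalgebra.mem_centralizer_iff, commute_iff_eq]

theorem two_mul_finrank_centralizer_le [FiniteDimensional F D] {x y : D} (hxy : ¬Commute x y) :
    2 * finrank F (Subalgebra.centralizer F {x}) ≤ finrank F D := by
  set C := Subalgebra.toSubmodule (Subalgebra.centralizer F {x})
  have hy₀ : y ≠ 0 := by rintro rfl; exact hxy (Commute.zero_right x)
  have hdisj : Disjoint C (C.map (LinearMap.mulRight F y)) := by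
    rw [Submodule.disjoint_def]
    rintro _ hc ⟨d, hd, rfl⟩
    exact neg_eq_zero.1 (eq_zero_of_commute_of_add_mul_eq_zero hxy
      ((mem_centralizer_singleton_iff F).1 hc).neg_right ((mem_centralizer_singleton_iff F).1 hd)
      (neg_add_cancel _)).1
  calc 2 * finrank F C = finrank F C + finrank F (C.map (LinearMap.mulRight F y)) := by
        rw [two_mul, (Submodule.equivMapOfInjective (LinearMap.mulRight F y)
          (mul_left_injective₀ hy₀) C).finrank_eq]
    _ ≤ finrank F D := Submodule.finrank_add_finrank_le_of_disjoint hdisj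

theorem linearIndependent_one_pair_of_not_commute {x y : D} (hxy : ¬Commute x y) :
    LinearIndependent F ![(1 : D), x] := by
  rw [LinearIndependent.pair_iff' one_ne_zero]
  rintro a rfl
  exact hxy ((Commute.one_left y).smul_left a)

theorem injective_liftHom_of_not_commute {a b c : F} (q : QuaternionAlgebra.Basis D a b c)
    (hq : ¬Commute q.i q.j) : Function.Injective q.liftHom := by
  rw [injective_iff_map_eq_zero]
  intro x hx
  rw [QuaternionAlgebra.Basis.liftHom_apply, QuaternionAlgebra.Basis.lift] at hx
  have hcomm (r s : F) : Commute q.i (r • 1 + s • q.i) :=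
    ((Commute.one_right q.i).smul_right r).add_right ((Commute.refl q.i).smul_right s)
  obtain ⟨h₁, h₂⟩ := eq_zero_of_commute_of_add_mul_eq_zero hq (hcomm x.re x.imI)
    (hcomm x.imJ x.imK) (by
      rw [← hx, Algebra.algebraMap_eq_smul_one, add_mul, smul_mul_assoc, smul_mul_assoc,
        one_mul, q.i_mul_j, ← add_assoc])
  have hli : LinearIndependent F ![1, q.i] := linearIndependent_one_pair_of_not_commute hq
  rw [LinearIndependent.pair_iff] at hli
  obtain ⟨hre, hI⟩ := hli _ _ h₁
  obtain ⟨hJ, hK⟩ := hli _ _ h₂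
  exact QuaternionAlgebra.ext hre hI hJ hK

section CharTwo

variable {R : Type*} [DivisionRing R] [CharP R 2]

theorem semiconjBy_add_one_of_mul_self {u y e : R} (hu : u * u = e + u) (he : Commute e y) :
    SemiconjBy (u * y + y * u) u (u + 1) :=
  calc (u * y + y * u) * u = u * y * u + y * (u * u) := by noncomm_ring
    _ = u * u * y + u * y * u + (u * y + y * u) := by rw [hu, add_mul, mul_add, he.eq]; grind
    _ = (u + 1) * (u * y + y * u) := by noncomm_ring

theorem semiconjBy_add_one_of_commute_mul_self {x y : R} (hx : Commute (x * x) y)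
    (hxy : ¬Commute x y) :
    SemiconjBy x (y * (x * y + y * x)⁻¹ * x) (y * (x * y + y * x)⁻¹ * x + 1) := by
  set z := x * y + y * x with hz
  have hz₀ : z ≠ 0 := by rwa [Ne, CharTwo.add_eq_zero]
  have hxz : Commute x z := by
    rw [commute_iff_eq, hz, mul_add, add_mul, mul_assoc y, ← hx.eq, ← mul_assoc, ← mul_assoc,
      add_comm]
  calc x * (y * z⁻¹ * x) = x * y * z⁻¹ * x := by simp only [mul_assoc]
    _ = (y * x + z) * z⁻¹ * x := by
      rw [hz, add_comm (x * y), ← add_assoc, CharTwo.add_self_eq_zero, zero_add]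
    _ = (y * z⁻¹ * x + 1) * x := by
        rw [add_mul, mul_inv_cancel₀ hz₀, mul_assoc y x, hxz.inv_right₀.eq, mul_assoc y]

end CharTwo

namespace IsQuaternionAlgebra

variable (hD : IsQuaternionAlgebra F D)
include hD

theorem finiteDimensional : FiniteDimensional F D :=
  finite_of_finrank_pos (by rw [hD.finrank_eq]; norm_num)

theorem exists_not_commute {x : D} (hx : x ∉ Set.range (algebraMap F D)) :
    ∃ y, ¬Commute x y := by
  by_contra! h
  have := hD.isCentral
  obtain ⟨a, ha⟩ := (Algebra.IsCentral.mem_center_iff F).1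
    (Subalgebra.mem_center_iff.2 fun y => (h y).symm)
  exact hx ⟨a, ha.symm⟩

theorem exists_exists_not_commute : ∃ x y : D, ¬Commute x y := by
  by_contra! h
  have hsurj (x : D) : ∃ a : F, a • (1 : D) = x := by
    by_contra hx
    obtain ⟨y, hy⟩ := hD.exists_not_commute (x := x)
      (by simpa only [Set.mem_range, Algebra.algebraMap_eq_smul_one] using hx)
    exact hy (h x y)
  have := finrank_le_one (1 : D) hsurj
  rw [hD.finrank_eq] at this
  omega

theorem mem_span_of_commute {x y z : D} (hxy : ¬Commute x y) (hxz : Commute x z) :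
    z ∈ Submodule.span F {1, x} := by
  have := hD.finiteDimensional
  have hle : Submodule.span F {1, x} ≤ Subalgebra.toSubmodule (Subalgebra.centralizer F {x}) := by
    rw [Submodule.span_le, Set.pair_subset_iff]
    exact ⟨(mem_centralizer_singleton_iff F).2 (Commute.one_right x),
      (mem_centralizer_singleton_iff F).2 (Commute.refl x)⟩
  have hspan : finrank F (Submodule.span F {1, x}) = 2 := by
    have h := finrank_span_eq_card (linearIndependent_one_pair_of_not_commute (F := F) hxy)
    rwa [Matrix.range_cons_cons_empty, Fintype.card_fin] at h
  have hcentralizer := two_mul_finrank_centralizer_le (F := F) hxy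
  rw [hD.finrank_eq] at hcentralizer
  have heq := Submodule.eq_of_le_of_finrank_le hle
    (by rw [hspan]; exact Nat.le_of_mul_le_mul_left hcentralizer two_pos)
  exact heq.ge <| (mem_centralizer_singleton_iff F).2 hxz

theorem exists_algebraMap_eq_of_commute {x y z : D} (hxy : ¬Commute x y) (hxz : Commute x z)
    (hyz : Commute y z) : ∃ a : F, algebraMap F D a = z := by
  obtain ⟨a, b, rfl⟩ := Submodule.mem_span_pair.1 (hD.mem_span_of_commute hxy hxz)
  rcases eq_or_ne b 0 with rfl | hb
  · exact ⟨a, by rw [zero_smul, add_zero, Algebra.algebraMap_eq_smul_one]⟩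
  · refine absurd ?_ hxy
    have hbx : Commute y (b • x) := by
      simpa using hyz.sub_right ((Commute.one_right y).smul_right a)
    simpa [smul_smul, inv_mul_cancel₀ hb] using (hbx.smul_right b⁻¹).symm

variable [CharP F 2]

theorem exists_semiconjBy_add_one : ∃ u v : D, v ≠ 0 ∧ SemiconjBy v u (u + 1) := by
  have : CharP D 2 := charP_of_injective_algebraMap (algebraMap F D).injective 2
  obtain ⟨x, y, hxy⟩ := hD.exists_exists_not_commute
  obtain ⟨c, t, hx⟩ := Submodule.mem_span_pair.1 <|
    hD.mem_span_of_commute hxy ((Commute.refl x).mul_right (Commute.refl x))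
  rw [← Algebra.algebraMap_eq_smul_one] at hx
  rcases eq_or_ne t 0 with rfl | ht
  · rw [zero_smul, add_zero] at hx
    exact ⟨_, x, fun hx₀ => hxy (hx₀ ▸ Commute.zero_left y),
      semiconjBy_add_one_of_commute_mul_self (hx ▸ Algebra.commutes c y) hxy⟩
  · have hu : t⁻¹ • x * t⁻¹ • x = algebraMap F D (t⁻¹ * t⁻¹ * c) + t⁻¹ • x := by
      rw [smul_mul_smul_comm, ← hx, smul_add, smul_smul, inv_mul_cancel_right₀ ht, map_mul,
        Algebra.smul_def]
    refine ⟨t⁻¹ • x, _, ?_, semiconjBy_add_one_of_mul_self hu (Algebra.commutes _ y)⟩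
    rw [Ne, CharTwo.add_eq_zero, smul_mul_assoc, mul_smul_comm]
    exact fun h => hxy (smul_right_injective D (inv_ne_zero ht) h)

theorem exists_algEquiv : ∃ a b : F, Nonempty (ℍ[F, a, 1, b] ≃ₐ[F] D) := by
  have : CharP D 2 := charP_of_injective_algebraMap (algebraMap F D).injective 2
  obtain ⟨u, v, hv, hvu⟩ := hD.exists_semiconjBy_add_one
  have hne : ¬Commute u v := fun h => hv <| by
    simpa [SemiconjBy, ← h.eq, add_mul] using hvu
  have hvu' : SemiconjBy v (u + 1) u := by
    simpa [CharTwo.add_cancel_right] using hvu.add_right (SemiconjBy.one_right v)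
  have hcomm : Commute u (u + 1) := (Commute.refl u).add_right (Commute.one_right u)
  obtain ⟨a, ha⟩ := hD.exists_algebraMap_eq_of_commute hne ((Commute.refl u).mul_right hcomm)
    (hcomm.eq ▸ hvu'.mul_right hvu)
  obtain ⟨b, hb⟩ := hD.exists_algebraMap_eq_of_commute hne (hvu'.mul_left hvu).symm
    ((Commute.refl v).mul_right (Commute.refl v))
  let q : QuaternionAlgebra.Basis D a 1 b :=
    { i := u, j := v, k := u * v
      i_mul_i := by
        rw [← Algebra.algebraMap_eq_smul_one, ha, one_smul, mul_add, mul_one,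
          CharTwo.add_cancel_right]
      j_mul_j := by rw [← Algebra.algebraMap_eq_smul_one, hb]
      i_mul_j := rfl
      j_mul_i := by rw [hvu.eq, one_smul, CharTwo.sub_eq_add, add_mul, one_mul, add_comm] }
  have hinj := injective_liftHom_of_not_commute q hne
  have := hD.finiteDimensional
  have hsurj : Function.Surjective q.liftHom :=
    (LinearMap.injective_iff_surjective_of_finrank_eq_finrank (f := q.liftHom.toLinearMap)
      (by rw [QuaternionAlgebra.finrank_eq_four, hD.finrank_eq]; norm_num)).1 hinj
  exact ⟨a, b, ⟨AlgEquiv.ofBijective q.liftHom ⟨hinj, hsurj⟩⟩⟩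

theorem nonempty_involution : Nonempty (Involution F D) := by
  obtain ⟨a, b, ⟨e⟩⟩ := hD.exists_algEquiv
  exact ⟨{ toFun := fun x => e (star (e.symm x))
           map_add' := fun x y => by simp
           map_smul' := fun c x => by simp
           map_mul' := fun x y => by simp
           involutive' := fun x => by simp }⟩

end IsQuaternionAlgebra

end Structure

section Symmetric

variable {F D : Type*} [Field F] [DivisionRing D] [Algebra F D]

namespace Involution

variable (θ : Involution F D)

theorem toFun_add (x y : D) : θ.toFun (x + y) = θ.toFun x + θ.toFun y := θ.map_add' x y

theorem toFun_smul (c : F) (x : D) : θ.toFun (c • x) = c • θ.toFun x := θ.map_smul' c x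

theorem toFun_zero : θ.toFun 0 = 0 := θ.toLinearMap.map_zero

theorem toFun_one : θ.toFun 1 = 1 := by
  have h := θ.map_mul' (θ.toFun 1) 1
  rw [mul_one, θ.involutive', mul_one] at h
  exact h.symm

theorem toFun_inv (x : D) : θ.toFun x⁻¹ = (θ.toFun x)⁻¹ := by
  rcases eq_or_ne x 0 with rfl | hx
  · rw [inv_zero, toFun_zero, inv_zero]
  · apply eq_inv_of_mul_eq_one_left
    rw [← θ.map_mul', mul_inv_cancel₀ hx, toFun_one]

theorem mem_alt {x : D} : x ∈ θ.alt ↔ ∃ y, y - θ.toFun y = x := Iff.rfl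

/-- `Sym(D, θ) = {a | θ(a) = a}`, the kernel of the map whose image is `Alt(D, θ)`. -/
def sym : Submodule F D := LinearMap.ker ((LinearMap.id : D →ₗ[F] D) - θ.toLinearMap)

variable {θ} in
theorem mem_sym {x : D} : x ∈ θ.sym ↔ θ.toFun x = x :=
  sub_eq_zero.trans eq_comm

theorem one_mem_sym : 1 ∈ θ.sym := mem_sym.2 θ.toFun_one

theorem finrank_alt_add_finrank_sym [FiniteDimensional F D] :
    finrank F θ.alt + finrank F θ.sym = finrank F D :=
  LinearMap.finrank_range_add_finrank_ker _

theorem alt_le_sym [CharP F 2] : θ.alt ≤ θ.sym := by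
  have : CharP D 2 := charP_of_injective_algebraMap (algebraMap F D).injective 2
  rintro _ ⟨y, rfl⟩
  refine mem_sym.2 ?_
  change θ.toFun (y - θ.toFun y) = y - θ.toFun y
  rw [CharTwo.sub_eq_add, toFun_add, θ.involutive', add_comm]

variable {θ}

theorem mul_mem_sym_of_commute {x y : D} (hx : x ∈ θ.sym) (hy : y ∈ θ.sym) (hxy : Commute x y) :
    x * y ∈ θ.sym := by
  rw [mem_sym, θ.map_mul', mem_sym.1 hx, mem_sym.1 hy, hxy.eq]

theorem inv_mem_sym {x : D} (hx : x ∈ θ.sym) : x⁻¹ ∈ θ.sym := by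
  rw [mem_sym, toFun_inv, mem_sym.1 hx]

theorem sandwich_mem_sym {x : D} (hx : x ∈ θ.sym) (d : D) : θ.toFun d * (x * d) ∈ θ.sym := by
  rw [mem_sym, θ.map_mul', θ.map_mul', mem_sym.1 hx, θ.involutive', mul_assoc]

theorem exists_mem_sym_mul_eq_mul (hsym : ∀ x ∈ θ.sym, ∀ y ∈ θ.sym, Commute x y) {s d : D}
    (hs : s ∈ θ.sym) (hd : d ≠ 0) : ∃ t ∈ θ.sym, d * t = s * d := by
  have hθd : θ.toFun d ≠ 0 := fun h => hd <| by rw [← θ.involutive' d, h, toFun_zero]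
  have hnorm : (θ.toFun d * d)⁻¹ ∈ θ.sym :=
    inv_mem_sym (by simpa using sandwich_mem_sym θ.one_mem_sym d)
  have hsandwich := sandwich_mem_sym hs d
  refine ⟨(θ.toFun d * d)⁻¹ * (θ.toFun d * (s * d)),
    mul_mem_sym_of_commute hnorm hsandwich (hsym _ hnorm _ hsandwich), ?_⟩
  rw [mul_inv_rev, mul_assoc d⁻¹, mul_inv_cancel_left₀ hd, inv_mul_cancel_left₀ hθd]

theorem commute_of_forall_mem_sym_commute (hsym : ∀ x ∈ θ.sym, ∀ y ∈ θ.sym, Commute x y) {s : D}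
    (hs : s ∈ θ.sym) (d : D) : Commute s d := by
  rcases eq_or_ne d 0 with rfl | hd
  · exact Commute.zero_right s
  rcases eq_or_ne (1 + d) 0 with hd₁ | hd₁
  · rw [eq_neg_of_add_eq_zero_right hd₁]
    exact (Commute.one_right s).neg_right
  -- Comparing the conjugates of `s` by `d` and by `1 + d` expresses `d` through elements of `Sym`.
  obtain ⟨t, ht, hdt⟩ := exists_mem_sym_mul_eq_mul hsym hs hd
  obtain ⟨t₁, ht₁, hdt₁⟩ := exists_mem_sym_mul_eq_mul hsym hs hd₁
  have hmul : d * (t₁ - t) = s - t₁ := by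
    rw [add_mul, one_mul, mul_add, mul_one, ← hdt] at hdt₁
    rw [mul_sub, sub_eq_sub_iff_add_eq_add, add_comm, hdt₁]
  rcases eq_or_ne t₁ t with rfl | hne
  · rw [sub_self, mul_zero, eq_comm, sub_eq_zero] at hmul
    rw [commute_iff_eq, ← hdt, ← hmul]
  · rw [(eq_mul_inv_iff_mul_eq₀ (sub_ne_zero.2 hne)).2 hmul]
    exact ((Commute.refl s).sub_right (hsym s hs t₁ ht₁)).mul_right
      ((hsym s hs t₁ ht₁).sub_right (hsym s hs t ht)).inv_right₀

end Involution

theorem commute_of_mem_of_finrank_le_two {S : Submodule F D} [FiniteDimensional F S] (h₁ : 1 ∈ S)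
    (hS : finrank F S ≤ 2) {x y : D} (hx : x ∈ S) (hy : y ∈ S) : Commute x y := by
  by_contra hxy
  have hspan := finrank_span_eq_card (linearIndependent_one_pair_of_not_commute (F := F) hxy)
  rw [Matrix.range_cons_cons_empty, Fintype.card_fin] at hspan
  have heq : Submodule.span F {1, x} = S := Submodule.eq_of_le_of_finrank_le
    (Submodule.span_le.2 (Set.pair_subset h₁ hx)) (hspan ▸ hS)
  obtain ⟨a, b, rfl⟩ := Submodule.mem_span_pair.1 (heq.ge hy)
  exact hxy (((Commute.one_right x).smul_right a).add_right ((Commute.refl x).smul_right b))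

namespace IsQuaternionAlgebra

variable [CharP F 2] (hD : IsQuaternionAlgebra F D) (θ : Involution F D)
include hD

theorem exists_mem_sym_not_commute : ∃ x ∈ θ.sym, ∃ y ∈ θ.sym, ¬Commute x y := by
  have := hD.finiteDimensional
  obtain ⟨x, y, hxy⟩ := hD.exists_exists_not_commute
  by_contra! hsym
  have hcentral : θ.sym ≤ F ∙ (1 : D) := fun s hs => by
    have hs_comm := Involution.commute_of_forall_mem_sym_commute hsym hs
    obtain ⟨a, rfl⟩ := hD.exists_algebraMap_eq_of_commute hxy (hs_comm x).symm (hs_comm y).symm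
    exact Submodule.mem_span_singleton.2 ⟨a, (Algebra.algebraMap_eq_smul_one a).symm⟩
  have h₁ := Submodule.finrank_mono hcentral
  have h₂ := Submodule.finrank_mono θ.alt_le_sym
  have h₃ := θ.finrank_alt_add_finrank_sym
  rw [finrank_span_singleton one_ne_zero] at h₁
  rw [hD.finrank_eq] at h₃
  omega

theorem finrank_sym : finrank F θ.sym = 3 := by
  have := hD.finiteDimensional
  obtain ⟨x, hx, y, hy, hxy⟩ := hD.exists_mem_sym_not_commute θ
  have hne_top : θ.sym ≠ ⊤ := fun htop => hxy <| by
    have fixed (z : D) : θ.toFun z = z := Involution.mem_sym.1 (htop ▸ Submodule.mem_top)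
    rw [commute_iff_eq, ← fixed (x * y), θ.map_mul', fixed, fixed]
  have hlt := Submodule.finrank_lt hne_top
  have hgt : 2 < finrank F θ.sym := by
    by_contra! hle
    exact hxy (commute_of_mem_of_finrank_le_two θ.one_mem_sym hle hx hy)
  rw [hD.finrank_eq] at hlt
  omega

theorem finrank_alt : finrank F θ.alt = 1 := by
  have := hD.finiteDimensional
  have h := θ.finrank_alt_add_finrank_sym
  rw [hD.finrank_sym, hD.finrank_eq] at h
  omega

end IsQuaternionAlgebra

end Symmetric

theorem finrank_mulOpposite_self (D : Type*) [DivisionRing D] : finrank Dᵐᵒᵖ D = 1 :=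
  finrank_eq_one (1 : D) one_ne_zero fun d => ⟨MulOpposite.op d, by simp⟩

section UpperBounds

variable {F D : Type*} [Field F] [DivisionRing D] [Algebra F D]

namespace Involution

variable (θ : Involution F D)

theorem toFun_algebraMap (c : F) : θ.toFun (algebraMap F D c) = algebraMap F D c := by
  rw [Algebra.algebraMap_eq_smul_one, toFun_smul, toFun_one]

theorem quotSandwich_mk (d a : D) :
    θ.quotSandwich d (Submodule.Quotient.mk a) = Submodule.Quotient.mk (θ.toFun d * (a * d)) :=
  rfl

theorem quotSandwich_algebraMap (c : F) (x : D ⧸ θ.alt) :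
    θ.quotSandwich (algebraMap F D c) x = (c * c) • x := by
  obtain ⟨a, rfl⟩ := Submodule.Quotient.mk_surjective _ x
  rw [quotSandwich_mk, toFun_algebraMap, ← Algebra.commutes, ← Algebra.smul_def,
    ← Algebra.smul_def, smul_smul, Submodule.Quotient.mk_smul]

theorem add_toFun_mem_alt [CharP F 2] (x : D) : x + θ.toFun x ∈ θ.alt := by
  have : CharP D 2 := charP_of_injective_algebraMap (algebraMap F D).injective 2
  exact θ.mem_alt.2 ⟨x, CharTwo.sub_eq_add x _⟩

theorem alt_ne_top [FiniteDimensional F D] : θ.alt ≠ ⊤ := fun htop => by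
  have h := θ.finrank_alt_add_finrank_sym
  rw [htop, finrank_top, Nat.add_eq_left, Submodule.finrank_eq_zero] at h
  exact one_ne_zero ((Submodule.mem_bot F).1 (h ▸ θ.one_mem_sym))

variable {θ} in
theorem eq_zero_of_forall_mul_mem_alt [FiniteDimensional F D] {x : D}
    (hx : ∀ d, x * d ∈ θ.alt) : x = 0 := by
  by_contra hne
  exact θ.alt_ne_top <| (Submodule.eq_top_iff').2 fun a => by
    simpa [mul_inv_cancel_left₀ hne] using hx (x⁻¹ * a)

end Involution

theorem IsQuaternionAlgebra.finrank_map_mkQ_alt_sym [CharP F 2] (hD : IsQuaternionAlgebra F D)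
    (θ : Involution F D) : finrank F (θ.sym.map θ.alt.mkQ) = 2 := by
  have := hD.finiteDimensional
  have h := (θ.alt.mkQ.domRestrict θ.sym).finrank_range_add_finrank_ker
  rw [LinearMap.range_domRestrict, LinearMap.ker_domRestrict, Submodule.ker_mkQ,
    (Submodule.comapSubtypeEquivOfLe θ.alt_le_sym).finrank_eq, hD.finrank_alt, hD.finrank_sym] at h
  omega

variable {θ : Involution F D} {V : Type*} [AddCommGroup V] [Module Dᵐᵒᵖ V]

theorem HermitianForm.toFun_self_mem_sym (h : HermitianForm θ V) (x : V) :
    h.toFun x x ∈ θ.sym :=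
  Involution.mem_sym.2 (h.symm x x).symm

theorem HermitianForm.toFun_smul_op_right (h : HermitianForm θ V) (x y : V) (d : D) :
    h.toFun x (MulOpposite.op d • y) = h.toFun x y * d := by
  have := h.smul_smul x y 1 d
  rwa [MulOpposite.op_one, one_smul, θ.toFun_one, one_mul] at this

namespace QuadForm

variable (q : QuadForm θ V)

theorem polar_toFun (x y : V) :
    QuadraticMap.polar q.toFun x y = Submodule.Quotient.mk (q.polar.toFun x y) :=
  q.map_add x y

variable {q} in
theorem toFun_op_smul_eq_mk {x : V} {c : D} (hc : q.toFun x = Submodule.Quotient.mk c) (d : D) :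
    q.toFun (MulOpposite.op d • x) = Submodule.Quotient.mk (θ.toFun d * (c * d)) := by
  rw [q.map_smul, hc, θ.quotSandwich_mk]

variable {q} in
theorem polar_toFun_self [FiniteDimensional F D] {x : V} {c : D}
    (hc : q.toFun x = Submodule.Quotient.mk c) : q.polar.toFun x x = c + θ.toFun c := by
  rw [← sub_eq_zero]
  refine Involution.eq_zero_of_forall_mul_mem_alt (θ := θ) fun d => ?_
  have hadd := q.map_add x (MulOpposite.op d • x)
  have hx : x + MulOpposite.op d • x = MulOpposite.op (1 + d) • x := by
    rw [MulOpposite.op_add, MulOpposite.op_one, add_smul, one_smul]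
  rw [hx, toFun_op_smul_eq_mk hc, toFun_op_smul_eq_mk hc, hc, q.polar.toFun_smul_op_right,
    ← Submodule.Quotient.mk_sub, ← Submodule.Quotient.mk_sub, Eq.comm, Submodule.Quotient.eq,
    θ.toFun_add, θ.toFun_one] at hadd
  have hmem : θ.toFun d * c - θ.toFun (θ.toFun d * c) ∈ θ.alt := ⟨_, rfl⟩
  rw [θ.map_mul', θ.involutive'] at hmem
  convert θ.alt.add_mem hadd hmem using 1
  noncomm_ring

end QuadForm

section FieldStructure

variable [Module F V] [IsScalarTower F Dᵐᵒᵖ V]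

theorem op_algebraMap_smul (c : F) (x : V) : MulOpposite.op (algebraMap F D c) • x = c • x := by
  rw [← MulOpposite.algebraMap_apply, algebraMap_smul]

theorem IsQuaternionAlgebra.finrank_eq_four_mul (hD : IsQuaternionAlgebra F D) :
    finrank F V = 4 * finrank Dᵐᵒᵖ V := by
  rw [← finrank_mul_finrank F Dᵐᵒᵖ V, MulOpposite.finrank, hD.finrank_eq]
  norm_num

namespace HermitianForm

variable (h : HermitianForm θ V)

theorem toFun_smul_left (c : F) (x y : V) : h.toFun (c • x) y = c • h.toFun x y := by
  have := h.smul_smul x y (algebraMap F D c) 1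
  rwa [op_algebraMap_smul, MulOpposite.op_one, one_smul, θ.toFun_algebraMap, mul_one,
    ← Algebra.smul_def] at this

theorem toFun_smul_right (c : F) (x y : V) : h.toFun x (c • y) = c • h.toFun x y := by
  rw [h.symm, toFun_smul_left, θ.toFun_smul, ← h.symm]

/-- The map `x ↦ h(x, x)`, as a quadratic map over `F`. -/
def toQuadraticMap : QuadraticMap F V D :=
  LinearMap.BilinMap.toQuadraticMap
    (LinearMap.mk₂ F h.toFun h.add_left h.toFun_smul_left h.add_right h.toFun_smul_right)

theorem toQuadraticMap_apply (x : V) : h.toQuadraticMap x = h.toFun x x := rfl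

theorem polar_toQuadraticMap (x y : V) :
    QuadraticMap.polar h.toQuadraticMap x y = h.toFun x y + θ.toFun (h.toFun x y) :=
  (LinearMap.BilinMap.polar_toQuadraticMap x y).trans <| by
    rw [LinearMap.mk₂_apply, LinearMap.mk₂_apply, h.symm x y]

end HermitianForm

namespace QuadForm

variable (q : QuadForm θ V)

/-- The map underlying a quadratic form over `(D, θ)`, as a quadratic map over `F`. -/
def toQuadraticMap : QuadraticMap F V (D ⧸ θ.alt) :=
  QuadraticMap.ofPolar q.toFun
    (fun c x => by rw [← op_algebraMap_smul (D := D), q.map_smul, θ.quotSandwich_algebraMap])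
    (fun x x' y => by
      rw [polar_toFun, polar_toFun, polar_toFun, q.polar.add_left, Submodule.Quotient.mk_add])
    (fun c x y => by
      rw [polar_toFun, polar_toFun, q.polar.toFun_smul_left, Submodule.Quotient.mk_smul])

end QuadForm

variable [CharP F 2] [FiniteDimensional F V] {n : ℕ}

theorem HermitianForm.Anisotropic.finrank_le {h : HermitianForm θ V} (hh : h.Anisotropic)
    (hD : IsQuaternionAlgebra F D) (hF : DegreeOverSquaresEq F n) (hn : n ≠ 0) :
    finrank Dᵐᵒᵖ V ≤ n := by
  have := hD.finiteDimensional
  obtain ⟨U, -, hU, hle⟩ := exists_le_finrank_le_of_polar_eq_zero hF hn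
    (θ.alt.mkQ.compQuadraticMap h.toQuadraticMap) (U := ⊤) (S := θ.sym.map θ.alt.mkQ)
    (fun x _ y _ => by
      refine (QuadraticMap.polar_comp h.toQuadraticMap θ.alt.mkQ x y).trans ?_
      rw [h.polar_toQuadraticMap]
      exact (Submodule.Quotient.mk_eq_zero _).2 (θ.add_toFun_mem_alt _))
    (fun x _ => Submodule.mem_map_of_mem (h.toFun_self_mem_sym x))
  have hU_le := finrank_le_two_mul_of_anisotropic hF hn h.toQuadraticMap (hD.finrank_alt θ)
    (fun x hx => (Submodule.Quotient.mk_eq_zero _).1 (hU x hx))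
    (fun x _ hx => not_not.1 fun hx₀ => hh x hx₀ hx)
  rw [finrank_top, hD.finrank_eq_four_mul, hD.finrank_map_mkQ_alt_sym] at hle
  omega

theorem QuadForm.Anisotropic.finrank_le_of_isotropic {q : QuadForm θ V} (hq : q.Anisotropic)
    (hD : IsQuaternionAlgebra F D) (hF : DegreeOverSquaresEq F n) (hn : n ≠ 0)
    {W : Submodule Dᵐᵒᵖ V} (hW : ∀ x ∈ W, ∀ y ∈ W, q.polar.toFun x y = 0) :
    2 * finrank Dᵐᵒᵖ W ≤ n := by
  have := hD.finiteDimensional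
  obtain ⟨U, -, hU, hle⟩ := exists_le_finrank_le_of_polar_eq_zero hF hn q.toQuadraticMap
    (U := W.restrictScalars F) (S := θ.sym.map θ.alt.mkQ)
    (fun x hx y hy => (q.polar_toFun x y).trans (by rw [hW x hx y hy, Submodule.Quotient.mk_zero]))
    (fun x hx => by
      obtain ⟨c, hc⟩ := Submodule.Quotient.mk_surjective _ (q.toFun x)
      refine ⟨c, Involution.mem_sym.2 ?_, hc⟩
      have := charP_of_injective_algebraMap (algebraMap F D).injective 2
      rw [eq_comm, ← CharTwo.add_eq_zero, ← polar_toFun_self hc.symm, hW x hx x hx])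
  have hU₀ : U = ⊥ := (Submodule.eq_bot_iff U).2
    fun x hx => not_not.1 fun hx₀ => hq x hx₀ (hU x hx)
  have hfour : finrank F (W.restrictScalars F) = 4 * finrank Dᵐᵒᵖ W :=
    hD.finrank_eq_four_mul (V := W)
  rw [hU₀, finrank_bot, hD.finrank_map_mkQ_alt_sym, hfour] at hle
  omega

theorem QuadForm.two_mul_finrank_le_of_anisotropic (q : QuadForm θ V)
    (hD : IsQuaternionAlgebra F D) (hF : DegreeOverSquaresEq F n) (hn : n ≠ 0)
    {C : Submodule Dᵐᵒᵖ V} (hC : ∀ x ∈ C, q.polar.toFun x x = 0 → x = 0) :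
    2 * finrank Dᵐᵒᵖ C ≤ n := by
  have := hD.finiteDimensional
  have hle := finrank_le_two_mul_of_anisotropic hF hn q.polar.toQuadraticMap (hD.finrank_alt θ)
    (U := C.restrictScalars F)
    (fun x _ => by
      obtain ⟨c, hc⟩ := Submodule.Quotient.mk_surjective _ (q.toFun x)
      rw [q.polar.toQuadraticMap_apply, polar_toFun_self hc.symm]
      exact θ.add_toFun_mem_alt c)
    hC
  have hfour : finrank F (C.restrictScalars F) = 4 * finrank Dᵐᵒᵖ C :=
    hD.finrank_eq_four_mul (V := C)
  omega

theorem QuadForm.Anisotropic.two_mul_finrank_le {q : QuadForm θ V} (hq : q.Anisotropic)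
    (hD : IsQuaternionAlgebra F D) (hF : DegreeOverSquaresEq F n) (hn : n ≠ 0) :
    2 * finrank Dᵐᵒᵖ V ≤ 3 * n := by
  have : FiniteDimensional Dᵐᵒᵖ V := FiniteDimensional.right F Dᵐᵒᵖ V
  let B (x : V) : V →ₗ[Dᵐᵒᵖ] D :=
    { toFun := q.polar.toFun x
      map_add' := q.polar.add_right x
      map_smul' := fun d y => q.polar.toFun_smul_op_right x y d.unop }
  obtain ⟨W, C, hW, hC, hle⟩ :=
    exists_isotropic_anisotropic_finrank_le (finrank_mulOpposite_self D) (B := B)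
    fun x y hxy => (q.polar.symm x y).trans <| by
      rw [show q.polar.toFun x y = 0 from hxy, θ.toFun_zero]
  have hW_le := hq.finrank_le_of_isotropic hD hF hn hW
  have hC_le := q.two_mul_finrank_le_of_anisotropic hD hF hn hC
  omega

end FieldStructure

variable [CharP F 2] {n : ℕ}

theorem uPlus_le (hD : IsQuaternionAlgebra F D) (hF : DegreeOverSquaresEq F n) (hn : n ≠ 0)
    (θ : Involution F D) : uPlus θ ≤ n := by
  refine sSup_le ?_
  rintro _ ⟨V, _, _, _, h, hh, rfl⟩
  let _ : Module F V := Module.compHom V (algebraMap F Dᵐᵒᵖ)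
  have : IsScalarTower F Dᵐᵒᵖ V := IsScalarTower.of_algebraMap_smul fun _ _ => rfl
  have := hD.finiteDimensional
  have : FiniteDimensional F V := FiniteDimensional.trans F Dᵐᵒᵖ V
  exact_mod_cast hh.finrank_le hD hF hn

theorem uQuad_le (hD : IsQuaternionAlgebra F D) (hF : DegreeOverSquaresEq F n) (hn : n ≠ 0)
    (θ : Involution F D) : uQuad θ ≤ (3 * n / 2 : ℕ) := by
  refine sSup_le ?_
  rintro _ ⟨V, _, _, _, q, hq, rfl⟩
  let _ : Module F V := Module.compHom V (algebraMap F Dᵐᵒᵖ)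
  have : IsScalarTower F Dᵐᵒᵖ V := IsScalarTower.of_algebraMap_smul fun _ _ => rfl
  have := hD.finiteDimensional
  have : FiniteDimensional F V := FiniteDimensional.trans F Dᵐᵒᵖ V
  have h := hq.two_mul_finrank_le hD hF hn
  exact_mod_cast (by omega : finrank Dᵐᵒᵖ V ≤ 3 * n / 2)

end UpperBounds

section Diagonal

variable {F D : Type*} [Field F] [DivisionRing D] [Algebra F D] {ι : Type*} [Fintype ι]

theorem Involution.toFun_sum (θ : Involution F D) (f : ι → D) :
    θ.toFun (∑ i, f i) = ∑ i, θ.toFun (f i) :=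
  map_sum θ.toLinearMap f Finset.univ

/-- The diagonal hermitian form with symmetric coefficients `c i`. -/
def HermitianForm.diagonal (θ : Involution F D) (c : ι → D) (hc : ∀ i, c i ∈ θ.sym) :
    HermitianForm θ (ι → D) where
  toFun x y := ∑ i, θ.toFun (x i) * (c i * y i)
  add_left x x' y := by
    simp only [Pi.add_apply, θ.toFun_add, add_mul, Finset.sum_add_distrib]
  add_right x y y' := by simp only [Pi.add_apply, mul_add, Finset.sum_add_distrib]
  smul_smul x y d₁ d₂ := by
    simp only [Pi.smul_apply, MulOpposite.smul_eq_mul_unop, MulOpposite.unop_op, θ.map_mul',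
      Finset.mul_sum, Finset.sum_mul, mul_assoc]
  symm x y := by
    simp only [θ.toFun_sum, θ.map_mul', θ.involutive', Involution.mem_sym.1 (hc _), mul_assoc]

/-- The diagonal quadratic form with coefficients `c i + Alt(D, θ)`. -/
def QuadForm.diagonal (θ : Involution F D) (c : ι → D) : QuadForm θ (ι → D) where
  toFun x := Submodule.Quotient.mk (∑ i, θ.toFun (x i) * (c i * x i))
  polar := HermitianForm.diagonal θ (fun i => c i + θ.toFun (c i)) fun i => by
    rw [Involution.mem_sym, θ.toFun_add, θ.involutive', add_comm]
  map_smul x d := by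
    rw [θ.quotSandwich_mk]
    simp only [Pi.smul_apply, MulOpposite.smul_eq_mul_unop, MulOpposite.unop_op, θ.map_mul',
      Finset.mul_sum, Finset.sum_mul, mul_assoc]
  map_add x y := by
    rw [← Submodule.Quotient.mk_sub, ← Submodule.Quotient.mk_sub, Submodule.Quotient.eq,
      θ.mem_alt]
    refine ⟨∑ i, θ.toFun (y i) * (c i * x i), ?_⟩
    rw [θ.toFun_sum]
    simp only [HermitianForm.diagonal, ← Finset.sum_sub_distrib]
    refine Finset.sum_congr rfl fun i _ => ?_
    simp only [Pi.add_apply, θ.toFun_add, θ.map_mul', θ.involutive']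
    noncomm_ring

theorem HermitianForm.diagonal_nondegenerate {θ : Involution F D} {c : ι → D}
    (hc : ∀ i, c i ∈ θ.sym) (hc₀ : ∀ i, c i ≠ 0) :
    (HermitianForm.diagonal θ c hc).Nondegenerate := by
  classical
  intro x hx
  ext i
  have h := hx (Pi.single i 1)
  simp only [HermitianForm.diagonal, Pi.single_apply, mul_ite, mul_one, mul_zero,
    Finset.sum_ite_eq', Finset.mem_univ, if_true, mul_eq_zero, hc₀ i, or_false] at h
  rw [Pi.zero_apply, ← θ.involutive' (x i), h, θ.toFun_zero]

theorem finrank_mulOpposite_pi (ι : Type*) [Fintype ι] (D : Type*) [DivisionRing D] :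
    finrank Dᵐᵒᵖ (ι → D) = Fintype.card ι := by
  have : Module.Finite Dᵐᵒᵖ D := finite_of_finrank_eq_succ (finrank_mulOpposite_self D)
  simp [finrank_pi_fintype, finrank_mulOpposite_self]

end Diagonal

section UPlus

variable {F D : Type*} [Field F] [DivisionRing D] [Algebra F D]

theorem Involution.mem_alt_of_sandwich_mem_alt {θ : Involution F D} {d x : D} (hd : d ≠ 0)
    (hx : θ.toFun d * (x * d) ∈ θ.alt) : x ∈ θ.alt := by
  have h : θ.toFun d⁻¹ * (θ.toFun d * (x * d) * d⁻¹) ∈ θ.alt := θ.sandwich_mem_alt d⁻¹ hx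
  rwa [mul_assoc, mul_assoc, mul_inv_cancel₀ hd, mul_one, ← mul_assoc, ← θ.map_mul',
    mul_inv_cancel₀ hd, θ.toFun_one, one_mul] at h

theorem HermitianForm.anisotropic_diagonal_pair {θ : Involution F D} {s c : D} (hs : s ∈ θ.alt)
    (hs₀ : s ≠ 0) (hc : c ∉ θ.alt) (hsym : ∀ i, ![s, c] i ∈ θ.sym) :
    (HermitianForm.diagonal θ ![s, c] hsym).Anisotropic := by
  intro x hx h
  replace h : θ.toFun (x 0) * (s * x 0) + θ.toFun (x 1) * (c * x 1) = 0 :=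
    (Fin.sum_univ_two fun i => θ.toFun (x i) * (![s, c] i * x i)).symm.trans h
  have hx₁ : x 1 = 0 := by
    by_contra hx₁
    refine hc (Involution.mem_alt_of_sandwich_mem_alt hx₁ ?_)
    rw [eq_neg_of_add_eq_zero_right h]
    exact θ.alt.neg_mem (θ.sandwich_mem_alt (x 0) hs)
  have hx₀ : x 0 = 0 := by
    rw [hx₁, mul_zero, mul_zero, add_zero, mul_eq_zero, mul_eq_zero] at h
    rcases h with h | h
    · rw [← θ.involutive' (x 0), h, θ.toFun_zero]
    · exact h.resolve_left hs₀
  exact hx (funext (Fin.forall_fin_two.2 ⟨hx₀, hx₁⟩))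

theorem IsQuaternionAlgebra.exists_mem_alt_ne_zero [CharP F 2] (hD : IsQuaternionAlgebra F D)
    (θ : Involution F D) : ∃ s ∈ θ.alt, s ≠ 0 :=
  θ.alt.ne_bot_iff.1 fun h => by
    have halt := hD.finrank_alt θ
    rw [h, finrank_bot] at halt
    exact zero_ne_one halt

theorem two_le_uPlus [CharP F 2] (hD : IsQuaternionAlgebra F D) (θ : Involution F D) :
    2 ≤ uPlus θ := by
  have := hD.finiteDimensional
  obtain ⟨s, hs, hs₀⟩ := hD.exists_mem_alt_ne_zero θ
  obtain ⟨c, hc, hc_alt⟩ := Set.not_subset.1 fun h : θ.sym ≤ θ.alt => by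
    simpa [hD.finrank_sym, hD.finrank_alt] using Submodule.finrank_mono h
  have hsym : ∀ i, ![s, c] i ∈ θ.sym := Fin.forall_fin_two.2 ⟨θ.alt_le_sym hs, hc⟩
  have hanis := HermitianForm.anisotropic_diagonal_pair hs hs₀ hc_alt hsym
  have hrank := finrank_mulOpposite_pi (Fin 2) D
  exact le_sSup ⟨_, _, _, finite_of_finrank_eq_succ hrank, _, hanis, by rw [hrank]; rfl⟩

end UPlus

section Conjugation

variable {F D : Type*} [Field F] [DivisionRing D] [Algebra F D]

namespace Involution

/-- The involution `x ↦ s⁻¹ θ(x) s`, for a nonzero element `s` with `θ(s) = s`. -/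
def conj (θ : Involution F D) {s : D} (hs : s ∈ θ.sym) (hs₀ : s ≠ 0) : Involution F D where
  toLinearMap := LinearMap.mulLeft F s⁻¹ ∘ₗ LinearMap.mulRight F s ∘ₗ θ.toLinearMap
  map_mul' x y := by
    change s⁻¹ * (θ.toFun (x * y) * s) = s⁻¹ * (θ.toFun y * s) * (s⁻¹ * (θ.toFun x * s))
    rw [θ.map_mul', mul_assoc, mul_assoc, mul_assoc, mul_inv_cancel_left₀ hs₀]
  involutive' x := by
    change s⁻¹ * (θ.toFun (s⁻¹ * (θ.toFun x * s)) * s) = x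
    rw [θ.map_mul', θ.map_mul', θ.involutive', toFun_inv, mem_sym.1 hs, mul_assoc, mul_assoc,
      inv_mul_cancel₀ hs₀, mul_one, inv_mul_cancel_left₀ hs₀]

variable {θ : Involution F D} {s : D} (hs : s ∈ θ.sym) (hs₀ : s ≠ 0)

theorem mul_conj_toFun (x : D) : s * (θ.conj hs hs₀).toFun x = θ.toFun x * s :=
  mul_inv_cancel_left₀ hs₀ _

theorem mul_mem_alt_iff_mem_alt_conj {x : D} : s * x ∈ θ.alt ↔ x ∈ (θ.conj hs hs₀).alt := by
  have hmul (y : D) : s * (y - (θ.conj hs hs₀).toFun y) = s * y - θ.toFun (s * y) := by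
    rw [mul_sub, mul_conj_toFun, θ.map_mul', mem_sym.1 hs]
  simp only [mem_alt]
  constructor
  · rintro ⟨y, hy⟩
    refine ⟨s⁻¹ * y, mul_left_cancel₀ hs₀ ?_⟩
    rw [hmul, mul_inv_cancel_left₀ hs₀, hy]
  · rintro ⟨y, rfl⟩
    exact ⟨s * y, (hmul y).symm⟩

/-- The involution is the quaternion conjugation. In characteristic `2` this is expressed by
`Alt(D, γ) = F`, which makes `x + γ(x)` and `γ(x) x` scalars. -/
def IsConjugation (γ : Involution F D) : Prop := γ.alt = 1

end Involution

theorem IsQuaternionAlgebra.isConjugation_conj [CharP F 2] (hD : IsQuaternionAlgebra F D)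
    {θ : Involution F D} {s : D} (hs : s ∈ θ.alt) (hs₀ : s ≠ 0) :
    (θ.conj (θ.alt_le_sym hs) hs₀).IsConjugation := by
  have := hD.finiteDimensional
  have hle : 1 ≤ (θ.conj (θ.alt_le_sym hs) hs₀).alt := by
    rw [Submodule.one_le, ← Involution.mul_mem_alt_iff_mem_alt_conj, mul_one]
    exact hs
  refine (Submodule.eq_of_le_of_finrank_eq hle ?_).symm
  rw [hD.finrank_alt, Submodule.one_eq_span, finrank_span_singleton one_ne_zero]

namespace Involution.IsConjugation

variable {γ : Involution F D} (hγ : γ.IsConjugation)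
include hγ

theorem exists_algebraMap_eq_toFun_mul_self (x : D) :
    ∃ a : F, algebraMap F D a = γ.toFun x * x := by
  have h : γ.toFun x * (1 * x) ∈ γ.alt :=
    γ.sandwich_mem_alt x (Submodule.one_le.1 hγ.ge)
  rw [one_mul] at h
  exact Submodule.mem_one.1 (hγ.le h)

/-- The reduced norm `γ(x) x`, as an element of `F`. -/
noncomputable def nrd (x : D) : F := (hγ.exists_algebraMap_eq_toFun_mul_self x).choose

theorem algebraMap_nrd (x : D) : algebraMap F D (hγ.nrd x) = γ.toFun x * x :=
  (hγ.exists_algebraMap_eq_toFun_mul_self x).choose_spec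

theorem nrd_algebraMap (a : F) : hγ.nrd (algebraMap F D a) = a ^ 2 := by
  apply (algebraMap F D).injective
  rw [algebraMap_nrd, γ.toFun_algebraMap, ← map_mul, sq]

theorem nrd_mul (x y : D) : hγ.nrd (x * y) = hγ.nrd x * hγ.nrd y := by
  apply (algebraMap F D).injective
  rw [map_mul, algebraMap_nrd, γ.map_mul', mul_assoc, ← mul_assoc (γ.toFun x), ← algebraMap_nrd,
    Algebra.left_comm, ← algebraMap_nrd]

theorem nrd_smul (a : F) (x : D) : hγ.nrd (a • x) = a ^ 2 * hγ.nrd x := by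
  apply (algebraMap F D).injective
  rw [algebraMap_nrd, γ.toFun_smul, smul_mul_smul_comm, ← sq, ← algebraMap_nrd, map_mul,
    Algebra.smul_def]

theorem nrd_eq_zero {x : D} : hγ.nrd x = 0 ↔ x = 0 := by
  rw [← map_eq_zero (algebraMap F D), algebraMap_nrd, mul_eq_zero, or_iff_right_of_imp]
  intro h
  rw [← γ.involutive' x, h, γ.toFun_zero]

variable [CharP F 2]

theorem exists_algebraMap_eq_add_toFun (x : D) : ∃ a : F, algebraMap F D a = x + γ.toFun x :=
  Submodule.mem_one.1 (hγ.le (γ.add_toFun_mem_alt x))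

/-- The reduced trace `x + γ(x)`, as an element of `F`. -/
noncomputable def trd (x : D) : F := (hγ.exists_algebraMap_eq_add_toFun x).choose

theorem algebraMap_trd (x : D) : algebraMap F D (hγ.trd x) = x + γ.toFun x :=
  (hγ.exists_algebraMap_eq_add_toFun x).choose_spec

theorem trd_add (x y : D) : hγ.trd (x + y) = hγ.trd x + hγ.trd y := by
  apply (algebraMap F D).injective
  rw [map_add, algebraMap_trd, algebraMap_trd, algebraMap_trd, γ.toFun_add]
  abel

theorem trd_smul (a : F) (x : D) : hγ.trd (a • x) = a * hγ.trd x := by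
  apply (algebraMap F D).injective
  rw [map_mul, algebraMap_trd, algebraMap_trd, γ.toFun_smul, Algebra.smul_def, Algebra.smul_def,
    mul_add]

theorem trd_eq_zero_of_mem_sym {x : D} (hx : x ∈ γ.sym) : hγ.trd x = 0 := by
  have : CharP D 2 := charP_of_injective_algebraMap (algebraMap F D).injective 2
  apply (algebraMap F D).injective
  rw [map_zero, algebraMap_trd, mem_sym.1 hx, CharTwo.add_self_eq_zero]

theorem trd_toFun (x : D) : hγ.trd (γ.toFun x) = hγ.trd x := by
  apply (algebraMap F D).injective
  rw [algebraMap_trd, algebraMap_trd, γ.involutive', add_comm]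

theorem trd_sandwich (x c : D) : hγ.trd (γ.toFun x * (c * x)) = hγ.nrd x * hγ.trd c := by
  apply (algebraMap F D).injective
  rw [algebraMap_trd, γ.map_mul', γ.map_mul', γ.involutive', mul_assoc, ← mul_add, ← add_mul,
    ← algebraMap_trd, Algebra.left_comm, ← algebraMap_nrd, ← map_mul, mul_comm]

theorem nrd_add (x y : D) : hγ.nrd (x + y) = hγ.nrd x + hγ.nrd y + hγ.trd (γ.toFun x * y) := by
  apply (algebraMap F D).injective
  simp only [map_add, algebraMap_nrd, algebraMap_trd, γ.toFun_add, γ.map_mul', γ.involutive',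
    add_mul, mul_add]
  abel

theorem nrd_toFun (x : D) : hγ.nrd (γ.toFun x) = hγ.nrd x := by
  apply (algebraMap F D).injective
  have hcomm := Algebra.commutes (hγ.trd x) x
  rw [algebraMap_trd, add_mul, mul_add, add_right_inj] at hcomm
  rw [algebraMap_nrd, algebraMap_nrd, γ.involutive', hcomm]

theorem trd_mul_comm (x y : D) : hγ.trd (x * y) = hγ.trd (y * x) := by
  have h := hγ.nrd_toFun (γ.toFun x + y)
  rw [γ.toFun_add, nrd_add, nrd_add, nrd_toFun, nrd_toFun, nrd_toFun, γ.involutive',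
    γ.involutive', add_right_inj, ← γ.map_mul', trd_toFun] at h
  exact h.symm

end Involution.IsConjugation

end Conjugation

section TernaryForm

variable {F D : Type*} [Field F] [CharP F 2] [DivisionRing D] [Algebra F D]

namespace Involution.IsConjugation

variable {γ : Involution F D} (hγ : γ.IsConjugation)
include hγ

theorem nrd_sandwich (x c : D) :
    hγ.nrd (γ.toFun x * (c * x)) = hγ.nrd x ^ 2 * hγ.nrd c := by
  rw [nrd_mul, nrd_mul, nrd_toFun]
  ring

theorem nrd_add_algebraMap {z : D} (hz : hγ.trd z = 1) (f : F) :
    hγ.nrd (z + algebraMap F D f) = hγ.nrd z + (f ^ 2 + f) := by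
  rw [nrd_add, nrd_algebraMap, ← Algebra.commutes, ← Algebra.smul_def, trd_smul, trd_toFun, hz]
  ring

theorem nrd_ne_sq_add_self {z : D} (hz : hγ.trd z = 1) (f : F) : hγ.nrd z ≠ f ^ 2 + f := by
  intro h
  have hzero := hγ.nrd_add_algebraMap hz f
  rw [h, CharTwo.add_self_eq_zero, nrd_eq_zero] at hzero
  rw [eq_neg_of_add_eq_zero_left hzero, ← map_neg, hγ.trd_eq_zero_of_mem_sym
    (mem_sym.2 (γ.toFun_algebraMap _))] at hz
  exact zero_ne_one hz

theorem exists_trd_eq_one_nrd_eq {c d x y : D} (hc : hγ.trd c = 1) (hd : hγ.trd d = 1)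
    (hxy : hγ.nrd x + hγ.nrd y = 1) : ∃ z, hγ.trd z = 1 ∧
      hγ.nrd z = hγ.nrd (γ.toFun x * (c * x) + γ.toFun y * (d * y)) + hγ.nrd c + hγ.nrd d := by
  rcases eq_or_ne y 0 with rfl | hy
  · refine ⟨d, hd, ?_⟩
    rw [hγ.nrd_eq_zero.2 rfl, add_zero] at hxy
    rw [mul_zero, mul_zero, add_zero, nrd_sandwich, hxy, one_pow, one_mul,
      CharTwo.add_self_eq_zero, zero_add]
  · have hNy : hγ.nrd y ≠ 0 := hγ.nrd_eq_zero.not.2 hy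
    have hNw : hγ.nrd (y * γ.toFun x) = hγ.nrd y * hγ.nrd x := by rw [nrd_mul, nrd_toFun]
    set w := y * γ.toFun x with hw
    -- Because `nrd x ^ 2 + nrd y ^ 2 = 1`, adding `nrd c + nrd d` interchanges the weights
    -- `nrd x ^ 2` and `nrd y ^ 2` of `nrd c` and `nrd d`; the witness has the interchanged weights.
    refine ⟨hγ.nrd y • c + (hγ.nrd y)⁻¹ • (γ.toFun w * (d * w)), ?_, ?_⟩
    · rw [trd_add, trd_smul, trd_smul, trd_sandwich, hc, hd, hNw, mul_one, mul_one,
        inv_mul_cancel_left₀ hNy, add_comm, hxy]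
    · have hcyc : hγ.trd (γ.toFun c * (γ.toFun w * (d * w))) =
          hγ.trd (γ.toFun (γ.toFun x * (c * x)) * (γ.toFun y * (d * y))) := by
        simp only [hw, γ.map_mul', γ.involutive', ← mul_assoc]
        rw [trd_mul_comm]
        simp only [mul_assoc]
      have hsq : hγ.nrd x ^ 2 + hγ.nrd y ^ 2 = 1 := by
        rw [← CharTwo.add_sq, hxy, one_pow]
      rw [nrd_add, nrd_smul, nrd_smul, nrd_sandwich, γ.toFun_smul, smul_mul_smul_comm,
        mul_inv_cancel₀ hNy, one_smul, hcyc, hNw, nrd_add, nrd_sandwich, nrd_sandwich]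
      field_simp
      linear_combination (hγ.nrd c + hγ.nrd d) * hsq -
        (hγ.nrd x ^ 2 * hγ.nrd c + hγ.nrd y ^ 2 * hγ.nrd d) * CharTwo.two_eq_zero (R := F)

theorem add_ne_algebraMap {c d e : D} (hc : hγ.trd c = 1) (hd : hγ.trd d = 1)
    (he : hγ.trd e = 1) (hsum : hγ.nrd c + hγ.nrd d + hγ.nrd e = 0) (x y : D) (f : F) :
    γ.toFun x * (c * x) + γ.toFun y * (d * y) + e ≠ algebraMap F D f := by
  intro h
  have : CharP D 2 := charP_of_injective_algebraMap (algebraMap F D).injective 2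
  have hxy : hγ.nrd x + hγ.nrd y = 1 := by
    have htrd := congrArg hγ.trd h
    rwa [trd_add, trd_add, trd_sandwich, trd_sandwich, hc, hd, he, mul_one, mul_one,
      hγ.trd_eq_zero_of_mem_sym (mem_sym.2 (γ.toFun_algebraMap f)), CharTwo.add_eq_zero] at htrd
  obtain ⟨z, hz, hNz⟩ := hγ.exists_trd_eq_one_nrd_eq hc hd hxy
  refine hγ.nrd_ne_sq_add_self hz f ?_
  rw [hNz, eq_sub_of_add_eq h, CharTwo.sub_eq_add, add_comm _ e, nrd_add_algebraMap _ he]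
  linear_combination hsum

theorem eq_zero_of_add_mem_alt {c d e : D} (hc : hγ.trd c = 1) (hd : hγ.trd d = 1)
    (he : hγ.trd e = 1) (hsum : hγ.nrd c + hγ.nrd d + hγ.nrd e = 0) {x y z : D}
    (h : γ.toFun x * (c * x) + γ.toFun y * (d * y) + γ.toFun z * (e * z) ∈ γ.alt) : z = 0 := by
  by_contra hz
  have hsandwich (a b : D) : γ.toFun z⁻¹ * (γ.toFun a * (b * a) * z⁻¹) =
      γ.toFun (a * z⁻¹) * (b * (a * z⁻¹)) := by
    simp only [γ.map_mul', mul_assoc]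
  have hmem : γ.toFun z⁻¹ * ((γ.toFun x * (c * x) + γ.toFun y * (d * y) + γ.toFun z * (e * z)) *
      z⁻¹) ∈ γ.alt := γ.sandwich_mem_alt z⁻¹ h
  rw [add_mul, add_mul, mul_add, mul_add, hsandwich, hsandwich, hsandwich, mul_inv_cancel₀ hz,
    γ.toFun_one, mul_one, one_mul] at hmem
  obtain ⟨f, hf⟩ := Submodule.mem_one.1 (hγ.le hmem)
  exact hγ.add_ne_algebraMap hc hd he hsum _ _ f hf.symm

theorem eq_zero_of_sum_mem_alt {c x : Fin 3 → D} (hc : ∀ i, hγ.trd (c i) = 1)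
    (hsum : ∑ i, hγ.nrd (c i) = 0) (hx : ∑ i, γ.toFun (x i) * (c i * x i) ∈ γ.alt) : x = 0 := by
  ext i
  refine hγ.eq_zero_of_add_mem_alt (x := x (i + 1)) (y := x (i + 2)) (hc (i + 1)) (hc (i + 2))
    (hc i) ?_ ?_
  · rw [← hsum, Fin.sum_univ_three]
    fin_cases i <;> simp <;> abel
  · convert hx using 1
    rw [Fin.sum_univ_three]
    fin_cases i <;> simp <;> abel

theorem exists_trd_eq_one : ∃ u, hγ.trd u = 1 := by
  have : CharP D 2 := charP_of_injective_algebraMap (algebraMap F D).injective 2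
  obtain ⟨u, hu⟩ := γ.mem_alt.1 (Submodule.one_le.1 hγ.ge)
  refine ⟨u, (algebraMap F D).injective ?_⟩
  rw [algebraMap_trd, ← CharTwo.sub_eq_add, hu, map_one]

theorem exists_trd_eq_one_sum_nrd_eq_zero (hD : IsQuaternionAlgebra F D) :
    ∃ c : Fin 3 → D, (∀ i, hγ.trd (c i) = 1) ∧ ∑ i, hγ.nrd (c i) = 0 := by
  have : CharP D 2 := charP_of_injective_algebraMap (algebraMap F D).injective 2
  obtain ⟨u, hu⟩ := hγ.exists_trd_eq_one
  obtain ⟨w, hw, v, hv, hwv⟩ := hD.exists_mem_sym_not_commute γ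
  have htrd : hγ.trd (w * v) ≠ 0 := by
    rw [Ne, ← map_eq_zero (algebraMap F D), algebraMap_trd, γ.map_mul', mem_sym.1 hw,
      mem_sym.1 hv, CharTwo.add_eq_zero]
    exact hwv
  set a := (hγ.nrd u + hγ.nrd v + hγ.trd (γ.toFun u * v)) / hγ.trd (w * v)
  have haw : a • w ∈ γ.sym := γ.sym.smul_mem a hw
  have hu' : hγ.trd (u + a • w) = 1 := by
    rw [trd_add, hγ.trd_eq_zero_of_mem_sym haw, hu, add_zero]
  refine ⟨![u, u + a • w, u + a • w + v], Fin.forall_fin_succ.2 ⟨hu, Fin.forall_fin_two.2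
    ⟨hu', ?_⟩⟩, ?_⟩
  · change hγ.trd (u + a • w + v) = 1
    rw [trd_add, hγ.trd_eq_zero_of_mem_sym hv, hu', add_zero]
  · rw [Fin.sum_univ_three]
    change hγ.nrd u + hγ.nrd (u + a • w) + hγ.nrd (u + a • w + v) = 0
    rw [nrd_add _ (u + a • w), γ.toFun_add, mem_sym.1 haw, add_mul, trd_add, smul_mul_assoc,
      trd_smul, div_mul_cancel₀ _ htrd]
    linear_combination (hγ.nrd u + hγ.nrd (u + a • w) + hγ.nrd v + hγ.trd (γ.toFun u * v)) *
      CharTwo.two_eq_zero (R := F)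

end Involution.IsConjugation

theorem three_le_uTilde (hD : IsQuaternionAlgebra F D) (θ : Involution F D) : 3 ≤ uTilde θ := by
  obtain ⟨s, hs, hs₀⟩ := hD.exists_mem_alt_ne_zero θ
  have hs' := θ.alt_le_sym hs
  have hγ := hD.isConjugation_conj hs hs₀
  obtain ⟨c, hc, hsum⟩ := hγ.exists_trd_eq_one_sum_nrd_eq_zero hD
  have hanis : (QuadForm.diagonal θ fun i => s * c i).Anisotropic := by
    intro x hx₀ hx
    refine hx₀ (hγ.eq_zero_of_sum_mem_alt hc hsum ?_)
    have hmul (y z : D) :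
        s * ((θ.conj hs' hs₀).toFun y * (z * y)) = θ.toFun y * (s * z * y) := by
      rw [← mul_assoc, Involution.mul_conj_toFun, mul_assoc, mul_assoc]
    simp only [← Involution.mul_mem_alt_iff_mem_alt_conj, Finset.mul_sum, hmul]
    exact (Submodule.Quotient.mk_eq_zero _).1 hx
  have hpolar (i : Fin 3) : s * c i + θ.toFun (s * c i) = s := by
    rw [θ.map_mul', Involution.mem_sym.1 hs', ← Involution.mul_conj_toFun hs' hs₀, ← mul_add,
      ← hγ.algebraMap_trd, hc, map_one, mul_one]
  have hnons : (QuadForm.diagonal θ fun i => s * c i).Nonsingular :=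
    HermitianForm.diagonal_nondegenerate (fun i => θ.alt_le_sym (θ.add_toFun_mem_alt _)) fun i =>
      by rwa [hpolar]
  have hrank := finrank_mulOpposite_pi (Fin 3) D
  exact le_sSup ⟨_, _, _, finite_of_finrank_eq_succ hrank, _, hanis, hnons, by rw [hrank]; rfl⟩

end TernaryForm

section LocalField

theorem degreeOverSquaresEq_two {F : Type*} [Field F] [CharP F 2] {t : F}
    (hspan : ∀ x, ∃ g h, x = g ^ 2 + t * h ^ 2) (ht : ∀ g, g ^ 2 ≠ t) :
    DegreeOverSquaresEq F 2 := by
  have hind : LinearIndependent (frobenius F 2).fieldRange ![1, t] := by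
    refine (LinearIndependent.pair_iff' one_ne_zero).2 ?_
    rintro ⟨_, g, rfl⟩ hg
    exact ht g ((mul_one _).symm.trans hg)
  have htop : ⊤ ≤ Submodule.span (frobenius F 2).fieldRange (Set.range ![1, t]) := by
    intro x _
    obtain ⟨g, h, rfl⟩ := hspan x
    rw [Matrix.range_cons_cons_empty, Submodule.mem_span_pair]
    exact ⟨⟨g ^ 2, g, rfl⟩, ⟨h ^ 2, h, rfl⟩, congrArg₂ _ (mul_one _) (mul_comm _ _)⟩
  exact finrank_eq_card_basis (Basis.mk hind htop)

theorem coeff_pow_expChar {R : Type*} [CommRing R] (p : ℕ) [ExpChar R p] (f : PowerSeries R)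
    (n : ℕ) : PowerSeries.coeff n (f ^ p) =
      if p ∣ n then PowerSeries.coeff (n / p) f ^ p else 0 := by
  have hp := expChar_ne_zero R p
  have hfrob : (f.expand p hp).map (frobenius R p) = f ^ p :=
    MvPowerSeries.map_frobenius_expand p hp
  rw [← hfrob, PowerSeries.coeff_map, PowerSeries.coeff_expand, apply_ite (frobenius R p),
    map_zero, frobenius_def]

theorem sq_ne_laurentSeries_X {k : Type*} [Field k] (g : LaurentSeries k) :
    g ^ 2 ≠ algebraMap (PowerSeries k) (LaurentSeries k) PowerSeries.X := by
  intro h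
  rw [LaurentSeries.coe_algebraMap, HahnSeries.ofPowerSeries_X] at h
  have horder := congrArg HahnSeries.order h
  rw [HahnSeries.order_pow, HahnSeries.order_single one_ne_zero, two_nsmul] at horder
  omega

theorem exists_powerSeries_eq_sq_add_X_mul_sq {k : Type*} [Field k] [CharP k 2] [PerfectRing k 2]
    (f : PowerSeries k) : ∃ g h : PowerSeries k, f = g ^ 2 + PowerSeries.X * h ^ 2 := by
  choose r hr using surjective_frobenius k 2
  simp only [frobenius_def] at hr
  refine ⟨PowerSeries.mk fun n => r (PowerSeries.coeff (2 * n) f),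
    PowerSeries.mk fun n => r (PowerSeries.coeff (2 * n + 1) f), ?_⟩
  ext n
  rw [map_add, coeff_pow_expChar, PowerSeries.coeff_mk, hr]
  rcases n with _ | n
  · simp
  rw [PowerSeries.coeff_succ_X_mul, coeff_pow_expChar, PowerSeries.coeff_mk, hr]
  rcases Nat.even_or_odd' n with ⟨m, rfl | rfl⟩
  · rw [if_neg (by omega), if_pos (by omega), zero_add, Nat.mul_div_cancel' ⟨m, rfl⟩]
  · rw [if_pos (by omega), if_neg (by omega), add_zero, Nat.mul_div_cancel' (by omega)]

theorem exists_eq_sq_add_mul_sq_of_isFractionRing {R K : Type*} [CommRing R] [IsDomain R] [Field K]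
    [Algebra R K] [IsFractionRing R K] {t : R} (hR : ∀ r : R, ∃ g h, r = g ^ 2 + t * h ^ 2)
    (x : K) : ∃ g h, x = g ^ 2 + algebraMap R K t * h ^ 2 := by
  obtain ⟨a, b, hb, rfl⟩ := IsFractionRing.div_surjective (A := R) x
  have hb₀ : algebraMap R K b ≠ 0 := IsFractionRing.to_map_ne_zero_of_mem_nonZeroDivisors hb
  obtain ⟨g, h, hgh⟩ := hR (a * b)
  refine ⟨algebraMap R K g / algebraMap R K b, algebraMap R K h / algebraMap R K b, ?_⟩
  have hmap := congrArg (algebraMap R K) hgh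
  simp only [map_add, map_mul, map_pow] at hmap
  field_simp
  exact hmap

theorem IsLocalFieldCharTwo.degreeOverSquaresEq {F : Type*} [Field F] [CharP F 2]
    (hF : IsLocalFieldCharTwo F) : DegreeOverSquaresEq F 2 := by
  obtain ⟨n, -, ⟨e⟩⟩ := hF
  set t := algebraMap (PowerSeries (GaloisField 2 n)) (LaurentSeries (GaloisField 2 n))
    PowerSeries.X
  refine degreeOverSquaresEq_two (t := e.symm t) (fun x => ?_) fun g hg =>
    sq_ne_laurentSeries_X (e g) ?_
  · obtain ⟨g, h, hx⟩ := exists_eq_sq_add_mul_sq_of_isFractionRing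
      (exists_powerSeries_eq_sq_add_X_mul_sq (k := GaloisField 2 n)) (e x)
    refine ⟨e.symm g, e.symm h, e.injective ?_⟩
    simpa only [map_add, map_mul, map_pow, e.apply_symm_apply] using hx
  · rw [← map_pow, hg, e.apply_symm_apply]

end LocalField

section Main

variable {F D : Type*} [Field F] [DivisionRing D] [Algebra F D]

theorem uTilde_le_uQuad (θ : Involution F D) : uTilde θ ≤ uQuad θ := by
  refine sSup_le_sSup ?_
  rintro n ⟨V, hadd, hmod, hfin, q, hanis, -, hn⟩
  exact ⟨V, hadd, hmod, hfin, q, hanis, hn⟩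

theorem u_invariants_eq [CharP F 2] (hF : DegreeOverSquaresEq F 2) (hD : IsQuaternionAlgebra F D) :
    Nonempty (Involution F D) ∧
      ∀ θ : Involution F D, uPlus θ = 2 ∧ uQuad θ = 3 ∧ uTilde θ = 3 := by
  refine ⟨hD.nonempty_involution, fun θ => ?_⟩
  have huPlus := uPlus_le hD hF two_ne_zero θ
  have huQuad : uQuad θ ≤ 3 := uQuad_le hD hF two_ne_zero θ
  have huTilde := three_le_uTilde hD θ
  have hle := uTilde_le_uQuad θ
  exact ⟨huPlus.antisymm (two_le_uPlus hD θ), huQuad.antisymm (huTilde.trans hle),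
    (hle.trans huQuad).antisymm huTilde⟩

end Main

end GenQuad

theorem mainTheorem6 (F : Type*) [Field F] [CharP F 2] :
    (GenQuad.DegreeOverSquaresEq F 2 →
      ∀ (Q : Type*) [DivisionRing Q] [Algebra F Q], GenQuad.IsQuaternionAlgebra F Q →
        Nonempty (GenQuad.Involution F Q) ∧
        ∀ θ : GenQuad.Involution F Q,
          GenQuad.uPlus θ = 2 ∧ GenQuad.uQuad θ = 3 ∧ GenQuad.uTilde θ = 3) ∧
    (GenQuad.IsLocalFieldCharTwo F →
      GenQuad.DegreeOverSquaresEq F 2 ∧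
      ∀ (Q : Type*) [DivisionRing Q] [Algebra F Q], GenQuad.IsQuaternionAlgebra F Q →
        Nonempty (GenQuad.Involution F Q) ∧
        ∀ θ : GenQuad.Involution F Q,
          GenQuad.uPlus θ = 2 ∧ GenQuad.uQuad θ = 3 ∧ GenQuad.uTilde θ = 3) := by
  refine ⟨fun hF Q _ _ hQ => GenQuad.u_invariants_eq hF hQ, fun hF => ?_⟩
  have h := hF.degreeOverSquaresEq
  exact ⟨h, fun Q _ _ hQ => GenQuad.u_invariants_eq h hQ⟩
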